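/- All spaces are topological; regular spaces are assumed to be $T_1$ and paracompact spaces to be Hausdorff. A subset $X$ of a space $Z$ is a Souslin-$\mathcal F$ set in $Z$ if there are closed sets $F_s\subset Z$, indexed by the finite sequences $s$ of natural numbers, with $X=\bigcup_{\alpha\in\omega^\omega}\bigcap_{n\in\omega}F_{\alpha|n}$. A space is perfectly paracompact if it is paracompact and each of its closed subsets is a $G_\delta$ set. A mapping $f\colon X\to Y$ is $\mathbf\Sigma^0_2$-measurable if $f^{-1}(U)$ is a countable union of closed subsets of $X$ for every open $U\subset Y$, and piecewise continuous if $X$ can be covered by a sequence $X_0,X_1,\ldots$ of closed sets such that every restriction $f|X_n$ is continuous. Let $Y$ be a regular space, and let $X$ be a Souslin-$\mathcal F$ set in a regular space $Z$ such that $X$, with the subspace topology, is perfectly paracompact and first-countable. Let $f\colon X\to Y$ be a $\mathbf\Sigma^0_2$-measurable mapping which is not piecewise continuous. Then there exist a countable subset $D=\{d_n\colon n\in\omega\}$ of $X$ and a sequence $\langle U_n\colon n\in\omega\rangle$ of pairwise disjoint open sets in $Y$ such that (i) $f(d_n)\in U_n$ for every $n\in\omega$, (ii) $D$ is homeomorphic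 to the space $\mathbb Q$ of rational numbers, (iii) $\overline D\subset X$, where the bar denotes the closure in $Z$, (iv) $f(x)\notin\bigcup\{U_n\colon n\in\omega\}$ for every $x\in\overline D\setminus D$. -/

import Mathlib

open Set Topology

universe u v

/-- The `F_σ` sets, that is, the sets of class `Σ⁰₂`: countable unions of closed sets. -/
def IsSigmaTwo {X : Type u} [TopologicalSpace X] (A : Set X) : Prop :=
  ∃ F : ℕ → Set X, (∀ n, IsClosed (F n)) ∧ A = ⋃ n, F n

/-- `A` is a Souslin-`F` set in `Z`: the result of the `A`-operation applied to a system of closed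
subsets of `Z` indexed by the finite sequences of natural numbers. Here `PiNat.res α n` is the
initial segment `(α 0, …, α (n - 1))` of `α`, stored as a list in reverse order. -/
def IsSouslinF {Z : Type u} [TopologicalSpace Z] (A : Set Z) : Prop :=
  ∃ F : List ℕ → Set Z, (∀ s, IsClosed (F s)) ∧
    A = ⋃ α : ℕ → ℕ, ⋂ n : ℕ, F (PiNat.res α n)

/-- A perfectly paracompact space: a paracompact (Hausdorff) space in which every closed set is
a `G_δ` set. -/
structure IsPerfectlyParacompact (X : Type u) [TopologicalSpace X] : Prop where
  t2 : T2Space X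
  paracompact : ParacompactSpace X
  isGδ_of_isClosed : ∀ F : Set X, IsClosed F → IsGδ F

/-- `f` is `Σ⁰₂`-measurable: preimages of open sets are of class `Σ⁰₂`. -/
def IsSigmaTwoMeasurable {X : Type u} {Y : Type v} [TopologicalSpace X] [TopologicalSpace Y]
    (f : X → Y) : Prop :=
  ∀ U : Set Y, IsOpen U → IsSigmaTwo (f ⁻¹' U)

/-- `f` is piecewise continuous: its domain is covered by a sequence of closed sets such that the
restriction of `f` to each of them is continuous. -/
def IsPiecewiseContinuous {X : Type u} {Y : Type v} [TopologicalSpace X] [TopologicalSpace Y]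
    (f : X → Y) : Prop :=
  ∃ F : ℕ → Set X, (∀ n, IsClosed (F n)) ∧ (⋃ n, F n) = Set.univ ∧ ∀ n, ContinuousOn f (F n)

/-! Call a set small if countably many closed sets, on each of which `f` is continuous, cover it.
Small sets form a σ-ideal, and paracompactness together with perfectness makes smallness local
(`IsPerfectlyParacompact.isPiecewiseSmall_inter_of_isOpen`). Since `f` is not piecewise continuous,
`exists_isIrreducibleAt_union_closure` yields a point `x` and an open `U ∋ f x` such that, near `x`,
the points with values off `closure U` are still not small. This leaves room to repeat the choice
forever while all earlier points stay irreducible.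

The points form a tree in which every node has infinitely many children converging to it. Hence the
set `D` of all of them is countable, first-countable and crowded, so it is a copy of `ℚ` by
Sierpiński's theorem. Each node carries a finite sequence `σ`, and its point is irreducible inside
the Souslin part of `σ`, hence lies in the closed set `F σ`. A limit of `D` outside `D` follows an
infinite branch (`exists_branch`), so it lies in every `F` along that branch and therefore in `X`.
To keep its value out of every `U j`, write `f ⁻¹' U j` as a union of closed sets `C (U j) l`; the
closures of all late neighbourhoods miss each of these. -/

section SigmaTwo

variable {X : Type u} [TopologicalSpace X]

theorem IsClosed.isSigmaTwo {A : Set X} (hA : IsClosed A) : IsSigmaTwo A :=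
  ⟨fun _ => A, fun _ => hA, (iUnion_const A).symm⟩

theorem IsSigmaTwo.inter {A B : Set X} (hA : IsSigmaTwo A) (hB : IsSigmaTwo B) :
    IsSigmaTwo (A ∩ B) := by
  obtain ⟨F, hF, rfl⟩ := hA
  obtain ⟨G, hG, rfl⟩ := hB
  refine ⟨fun n => F n.unpair.1 ∩ G n.unpair.2, fun n => (hF _).inter (hG _), ?_⟩
  ext x
  simp only [mem_inter_iff, mem_iUnion]
  constructor
  · rintro ⟨⟨i, hi⟩, ⟨j, hj⟩⟩
    exact ⟨Nat.pair i j, by simpa using ⟨hi, hj⟩⟩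
  · rintro ⟨n, h1, h2⟩
    exact ⟨⟨_, h1⟩, ⟨_, h2⟩⟩

theorem IsPerfectlyParacompact.isSigmaTwo_of_isOpen (h : IsPerfectlyParacompact X) {O : Set X}
    (hO : IsOpen O) : IsSigmaTwo O := by
  obtain ⟨G, hG, hGO⟩ := isGδ_iff_eq_iInter_nat.1 (h.isGδ_of_isClosed _ hO.isClosed_compl)
  refine ⟨fun n => (G n)ᶜ, fun n => (hG n).isClosed_compl, ?_⟩
  rw [← compl_iInter, ← hGO, compl_compl]

end SigmaTwo

/-! ### The σ-ideal of piecewise small sets and irreducible points. -/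

section PiecewiseSmall

variable {X : Type u} {Y : Type v} [TopologicalSpace X] [TopologicalSpace Y]

/-- `E` is covered by countably many closed sets on each of which `f` is continuous. -/
def IsPiecewiseSmall (f : X → Y) (E : Set X) : Prop :=
  ∃ C : ℕ → Set X, (∀ n, IsClosed (C n)) ∧ (∀ n, ContinuousOn f (C n)) ∧ E ⊆ ⋃ n, C n

variable {f : X → Y}

theorem IsPiecewiseSmall.mono {E E' : Set X} (h : IsPiecewiseSmall f E') (hE : E ⊆ E') :
    IsPiecewiseSmall f E :=
  let ⟨C, h1, h2, h3⟩ := h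
  ⟨C, h1, h2, hE.trans h3⟩

theorem IsPiecewiseSmall.iUnion {E : ℕ → Set X} (h : ∀ n, IsPiecewiseSmall f (E n)) :
    IsPiecewiseSmall f (⋃ n, E n) := by
  choose C h1 h2 h3 using h
  refine ⟨fun n => C n.unpair.1 n.unpair.2, fun n => h1 _ _, fun n => h2 _ _, ?_⟩
  intro x hx
  obtain ⟨i, hi⟩ := mem_iUnion.1 hx
  obtain ⟨j, hj⟩ := mem_iUnion.1 (h3 i hi)
  exact mem_iUnion.2 ⟨Nat.pair i j, by simpa using hj⟩

theorem IsPiecewiseSmall.union {E E' : Set X} (h : IsPiecewiseSmall f E)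
    (h' : IsPiecewiseSmall f E') : IsPiecewiseSmall f (E ∪ E') := by
  refine (IsPiecewiseSmall.iUnion (E := fun n => if n = 0 then E else E') ?_).mono ?_
  · intro n
    split_ifs
    exacts [h, h']
  · rintro x (hx | hx)
    · exact mem_iUnion.2 ⟨0, by simpa using hx⟩
    · exact mem_iUnion.2 ⟨1, by simpa using hx⟩

theorem IsSigmaTwo.isPiecewiseSmall {P : Set X} (hP : IsSigmaTwo P) (hf : ContinuousOn f P) :
    IsPiecewiseSmall f P := by
  obtain ⟨F, hF, rfl⟩ := hP
  exact ⟨F, hF, fun n => hf.mono (subset_iUnion F n), Subset.rfl⟩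

theorem isPiecewiseContinuous_of_isPiecewiseSmall_univ (h : IsPiecewiseSmall f univ) :
    IsPiecewiseContinuous f :=
  let ⟨C, h1, h2, h3⟩ := h
  ⟨C, h1, univ_subset_iff.1 h3, h2⟩

/-- In a paracompact space, piecewise smallness is a local property. -/
theorem isPiecewiseSmall_inter_of_isClosed [ParacompactSpace X] [T2Space X] {E K : Set X}
    (hK : IsClosed K) (h : ∀ x ∈ K, ∃ W, IsOpen W ∧ x ∈ W ∧ IsPiecewiseSmall f (W ∩ E)) :
    IsPiecewiseSmall f (K ∩ E) := by
  choose! W hWo hxW hWE using h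
  obtain ⟨v, hvo, hKv, hvf, hvW⟩ := precise_refinement_set hK (fun x : K => W x)
    (fun x => hWo x x.2) (fun x hx => mem_iUnion.2 ⟨⟨x, hx⟩, hxW x hx⟩)
  obtain ⟨c, hKc, hcc, hcv⟩ := exists_subset_iUnion_closed_subset hK hvo
    (fun x _ => hvf.point_finite x) hKv
  have hE : ∀ i : K, IsPiecewiseSmall f (W i ∩ E) := fun i => hWE i i.2
  choose C hC1 hC2 hC3 using hE
  -- For fixed `n` these pieces form a locally finite closed family, so their union is closed and
  -- continuity glues over it.
  have hcf : ∀ n, LocallyFinite fun i => c i ∩ C i n := fun n =>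
    hvf.subset fun i => inter_subset_left.trans (hcv i)
  refine ⟨fun n => ⋃ i, c i ∩ C i n, fun n => (hcf n).isClosed_iUnion fun i =>
    (hcc i).inter (hC1 i n), fun n => (hcf n).continuousOn_iUnion
    (fun i => (hcc i).inter (hC1 i n)) fun i => (hC2 i n).mono inter_subset_right, ?_⟩
  rintro x ⟨hxK, hxE⟩
  obtain ⟨i, hi⟩ := mem_iUnion.1 (hKc hxK)
  obtain ⟨n, hn⟩ := mem_iUnion.1 (hC3 i ⟨hvW i (hcv i hi), hxE⟩)
  exact mem_iUnion.2 ⟨n, mem_iUnion.2 ⟨i, hi, hn⟩⟩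

theorem IsPerfectlyParacompact.isPiecewiseSmall_inter_of_isOpen (hX : IsPerfectlyParacompact X)
    {E O : Set X} (hO : IsOpen O)
    (h : ∀ x ∈ O, ∃ W, IsOpen W ∧ x ∈ W ∧ IsPiecewiseSmall f (W ∩ E)) :
    IsPiecewiseSmall f (O ∩ E) := by
  have := hX.t2
  have := hX.paracompact
  obtain ⟨F, hF, rfl⟩ := hX.isSigmaTwo_of_isOpen hO
  rw [iUnion_inter]
  exact .iUnion fun n => isPiecewiseSmall_inter_of_isClosed (hF n) fun x hx =>
    h x (mem_iUnion.2 ⟨n, hx⟩)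

/-- `x` is irreducible in `E` outside `A`: every neighbourhood of `x` contains
a set of points of `E` with values outside `A` which is not piecewise small. -/
def IsIrreducibleAt (f : X → Y) (E : Set X) (A : Set Y) (x : X) : Prop :=
  ∀ W, IsOpen W → x ∈ W → ¬ IsPiecewiseSmall f (W ∩ (E ∩ f ⁻¹' Aᶜ))

theorem IsIrreducibleAt.anti {E : Set X} {A B : Set Y} {x : X} (h : IsIrreducibleAt f E B x)
    (hAB : A ⊆ B) : IsIrreducibleAt f E A x := fun W hW hx hs =>
  h W hW hx (hs.mono (by gcongr))

theorem IsIrreducibleAt.mem_closure {E : Set X} {A : Set Y} {x : X}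
    (h : IsIrreducibleAt f E A x) : x ∈ closure E := by
  refine mem_closure_iff.2 fun W hW hx => ?_
  by_contra hne
  refine h W hW hx ⟨fun _ => ∅, fun _ => isClosed_empty, fun _ => continuousOn_empty _, ?_⟩
  rintro y ⟨hy, hyE, -⟩
  exact (hne ⟨y, hy, hyE⟩).elim

/-- Of two disjoint sets, at least one can be added to `A` keeping `x` irreducible. -/
theorem IsIrreducibleAt.union_or {E : Set X} {A B B' : Set Y} {x : X}
    (h : IsIrreducibleAt f E A x) (hB : Disjoint B B') :
    IsIrreducibleAt f E (A ∪ B) x ∨ IsIrreducibleAt f E (A ∪ B') x := by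
  by_contra! hne
  simp only [IsIrreducibleAt, not_forall, not_not] at hne
  obtain ⟨⟨W, hW, hxW, hs⟩, W', hW', hxW', hs'⟩ := hne
  refine h (W ∩ W') (hW.inter hW') ⟨hxW, hxW'⟩ ((hs.union hs').mono ?_)
  rintro y ⟨⟨hy, hy'⟩, hyE, hyA⟩
  by_cases hyB : f y ∈ B
  · exact Or.inr ⟨hy', hyE, fun h' => h'.elim hyA (disjoint_left.1 hB hyB)⟩
  · exact Or.inl ⟨hy, hyE, fun h' => h'.elim hyA hyB⟩

theorem exists_isOpen_closure_disjoint [RegularSpace Y] {A : Set Y} (hA : IsClosed A) {y : Y}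
    (hy : y ∉ A) : ∃ U, IsOpen U ∧ y ∈ U ∧ Disjoint (closure U) A := by
  obtain ⟨K, ⟨hK, hKc⟩, hKA⟩ := (closed_nhds_basis y).mem_iff.1 (hA.isOpen_compl.mem_nhds hy)
  refine ⟨interior K, isOpen_interior, mem_interior_iff_mem_nhds.2 hK, ?_⟩
  exact (disjoint_compl_left (a := A)).mono_left
    ((closure_minimal interior_subset hKc).trans hKA)

/-- If no such point existed, `f` would be continuous on the `F_σ` set of points of `V` with values
off `A` where smallness fails locally. That set would be small, and what remains is small by
locality. -/
theorem exists_isIrreducibleAt_union_closure [RegularSpace Y] (hX : IsPerfectlyParacompact X)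
    (hf : IsSigmaTwoMeasurable f) {E V : Set X} {A : Set Y} (hV : IsOpen V) (hA : IsClosed A)
    (h : ¬ IsPiecewiseSmall f (V ∩ (E ∩ f ⁻¹' Aᶜ))) :
    ∃ x ∈ V, ∃ U, IsOpen U ∧ f x ∈ U ∧ Disjoint (closure U) A ∧
      IsIrreducibleAt f E (A ∪ closure U) x := by
  by_contra! hno
  set O : Set X := ⋃₀ {W | IsOpen W ∧ IsPiecewiseSmall f (W ∩ (E ∩ f ⁻¹' Aᶜ))}
  have hO : IsOpen O := isOpen_sUnion fun W hW => hW.1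
  have hOs : IsPiecewiseSmall f (O ∩ (E ∩ f ⁻¹' Aᶜ)) :=
    hX.isPiecewiseSmall_inter_of_isOpen hO fun x ⟨W, hW, hx⟩ => ⟨W, hW.1, hx, hW.2⟩
  set P : Set X := V ∩ f ⁻¹' Aᶜ ∩ Oᶜ
  have hirr : ∀ x ∈ P, IsIrreducibleAt f E A x := fun x hx W hW hxW hs =>
    hx.2 ⟨W, ⟨hW, hs⟩, hxW⟩
  have hP : IsSigmaTwo P := ((hX.isSigmaTwo_of_isOpen hV).inter (hf _ hA.isOpen_compl)).inter
    hO.isClosed_compl.isSigmaTwo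
  have hcont : ContinuousOn f P := by
    intro x hx
    refine ((closed_nhds_basis (f x)).tendsto_right_iff).2 fun K ⟨hK, hKc⟩ => ?_
    obtain ⟨U₀, hU₀, hxU₀, hU₀A⟩ := exists_isOpen_closure_disjoint hA hx.1.2
    set U := U₀ ∩ interior K
    have hU : IsOpen U := hU₀.inter isOpen_interior
    have hxU : f x ∈ U := ⟨hxU₀, mem_interior_iff_mem_nhds.2 hK⟩
    have hUA : Disjoint (closure U) A := hU₀A.mono_left (closure_mono inter_subset_left)
    have hUK : closure U ⊆ K :=
      closure_minimal (inter_subset_right.trans interior_subset) hKc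
    have := hno x hx.1.1 U hU hxU hUA
    simp only [IsIrreducibleAt, not_forall, not_not] at this
    obtain ⟨W, hW, hxW, hWs⟩ := this
    filter_upwards [mem_nhdsWithin_of_mem_nhds (hW.mem_nhds hxW), self_mem_nhdsWithin]
      with x' hx'W hx'P
    by_contra hx'K
    obtain ⟨U', hU', hxU', hU'd⟩ := exists_isOpen_closure_disjoint
      (hA.union isClosed_closure) (y := f x') (A := A ∪ closure U)
      (fun hh => hh.elim hx'P.1.2 fun h' => hx'K (hUK h'))
    -- `closure U` and `closure U'` are disjoint, so one of them can be added at `x'`: adding `U'`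
    -- contradicts `hno`, adding `U` contradicts the smallness on `W`.
    rcases (hirr x' hx'P).union_or (hU'd.mono_right subset_union_right) with h1 | h1
    · exact hno x' hx'P.1.1 U' hU' hxU' (hU'd.mono_right subset_union_left) h1
    · exact h1 W hW hx'W hWs
  refine h ((hOs.union (hP.isPiecewiseSmall hcont)).mono ?_)
  rintro x ⟨hxV, hxE, hxA⟩
  by_cases hxO : x ∈ O
  · exact Or.inl ⟨hxO, hxE, hxA⟩
  · exact Or.inr ⟨⟨hxV, hxA⟩, hxO⟩

/-- The new point can be chosen so that finitely many given points stay irreducible. -/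
theorem exists_isIrreducibleAt_union_closure_of_finite [RegularSpace Y]
    (hX : IsPerfectlyParacompact X) (hf : IsSigmaTwoMeasurable f) {E V : Set X} (hV : IsOpen V)
    {ι : Type*} (s : Finset ι) (e : ι → Set X) (p : ι → X) {A : Set Y} (hA : IsClosed A)
    (hs : ∀ i ∈ s, IsIrreducibleAt f (e i) A (p i))
    (h : ¬ IsPiecewiseSmall f (V ∩ (E ∩ f ⁻¹' Aᶜ))) :
    ∃ x ∈ V, ∃ U, IsOpen U ∧ f x ∈ U ∧ Disjoint (closure U) A ∧
      IsIrreducibleAt f E (A ∪ closure U) x ∧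
      ∀ i ∈ s, IsIrreducibleAt f (e i) (A ∪ closure U) (p i) := by
  classical
  induction s using Finset.induction_on generalizing A with
  | empty =>
    obtain ⟨x, hx, U, h1, h2, h3, h4⟩ := exists_isIrreducibleAt_union_closure hX hf hV hA h
    exact ⟨x, hx, U, h1, h2, h3, h4, by simp⟩
  | insert a s has ih =>
    simp only [Finset.forall_mem_insert] at hs ⊢
    obtain ⟨x, hx, U, hU, hxU, hUA, hirr, hirrs⟩ := ih hA hs.2 h
    -- If `U` spoils `p a`, a second choice `U'` with closure disjoint from `closure U` cannot spoil
    -- it as well.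
    by_cases ha : IsIrreducibleAt f (e a) (A ∪ closure U) (p a)
    · exact ⟨x, hx, U, hU, hxU, hUA, hirr, ha, hirrs⟩
    obtain ⟨x', hx', U', hU', hxU', hUA', hirr', hirrs'⟩ :=
      ih (hA.union isClosed_closure) hirrs (hirr V hV hx)
    have hsub : A ∪ closure U' ⊆ A ∪ closure U ∪ closure U' :=
      union_subset_union_left _ subset_union_left
    exact ⟨x', hx', U', hU', hxU', hUA'.mono_right subset_union_left, hirr'.anti hsub,
      (hs.1.union_or (hUA'.mono_right subset_union_right)).resolve_right ha,
      fun i hi => (hirrs' i hi).anti hsub⟩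

end PiecewiseSmall

/-! ### Sierpiński's theorem via clopen schemes. -/

section CountableCrowded

/-- Only countably many distances from `x` occur; a ball whose radius is not one of them is clopen.
-/
theorem exists_isClopen_mem_subset {T : Type*} [MetricSpace T] [Countable T] {x : T} {N : Set T}
    (hN : N ∈ 𝓝 x) : ∃ B, IsClopen B ∧ x ∈ B ∧ B ⊆ N := by
  obtain ⟨ε, hε, hεN⟩ := Metric.mem_nhds_iff.1 hN
  have hd : Dense (range fun y => dist y x)ᶜ := (countable_range _).dense_compl ℝ
  obtain ⟨r, hr, hr0, hrε⟩ := hd.exists_between hε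
  refine ⟨Metric.ball x r, ⟨?_, Metric.isOpen_ball⟩, Metric.mem_ball_self hr0,
    (Metric.ball_subset_ball hrε.le).trans hεN⟩
  have : Metric.ball x r = Metric.closedBall x r :=
    Subset.antisymm Metric.ball_subset_closedBall fun y hy =>
      lt_of_le_of_ne hy fun h => hr ⟨y, h⟩
  rw [this]
  exact Metric.isClosed_closedBall

/-- The pieces are the successive differences of clopen sets shrinking strictly to `x`. -/
theorem exists_clopen_partition {T : Type*} [MetricSpace T] [Countable T]
    [∀ x : T, (𝓝[≠] x).NeBot] {V : Set T} (hV : IsClopen V) {x : T} (hx : x ∈ V) :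
    ∃ P : ℕ → Set T, (∀ k, IsClopen (P k)) ∧ (∀ k, (P k).Nonempty) ∧
      Pairwise (Function.onFun Disjoint P) ∧ V = insert x (⋃ k, P k) ∧ (∀ k, x ∉ P k) ∧
      ∀ N ∈ 𝓝 x, ∃ K, ∀ k ≥ K, P k ⊆ N := by
  obtain ⟨N, hN⟩ := (𝓝 x).exists_antitone_basis
  have step : ∀ (n : ℕ) (B : {B : Set T // IsClopen B ∧ x ∈ B}),
      ∃ B' : {B : Set T // IsClopen B ∧ x ∈ B}, B'.1 ⊆ B.1 ∩ N n ∧ (B.1 \ B'.1).Nonempty := by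
    rintro n ⟨B, hB, hxB⟩
    have hBx : B ∈ 𝓝[≠] x := mem_nhdsWithin_of_mem_nhds (hB.isOpen.mem_nhds hxB)
    obtain ⟨y, hyB, hyx⟩ :=
      ((𝓝[≠] x).nonempty_of_mem (Filter.inter_mem hBx self_mem_nhdsWithin))
    obtain ⟨B', hB', hxB', hs⟩ := exists_isClopen_mem_subset
      (Filter.inter_mem (Filter.inter_mem (hB.isOpen.mem_nhds hxB) (hN.1.mem_of_mem (i := n) trivial))
        (isOpen_compl_singleton.mem_nhds (Ne.symm hyx : x ≠ y)))
    exact ⟨⟨B', hB', hxB'⟩, fun z hz => (hs hz).1, y, hyB, fun hy => (hs hy).2 rfl⟩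
  choose g hg1 hg2 using step
  let B : ℕ → {B : Set T // IsClopen B ∧ x ∈ B} := fun n => Nat.rec ⟨V, hV, hx⟩ g n
  have hBs : ∀ n, (B (n + 1)).1 ⊆ (B n).1 ∩ N n := fun n => hg1 n (B n)
  have hBa : Antitone fun n => (B n).1 :=
    antitone_nat_of_succ_le fun n => (hBs n).trans inter_subset_left
  refine ⟨fun k => (B k).1 \ (B (k + 1)).1, fun k => (B k).2.1.diff (B (k + 1)).2.1,
    fun k => hg2 k (B k), ?_, ?_, fun k h => h.2 (B (k + 1)).2.2, ?_⟩
  · refine (pairwise_disjoint_on _).2 fun m n hmn => disjoint_left.2 fun y hy hy' => ?_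
    exact hy.2 (hBa hmn hy'.1)
  · apply Subset.antisymm
    · intro y hy
      by_contra hne
      rw [mem_insert_iff, not_or, mem_iUnion, not_exists] at hne
      have hall : ∀ n, y ∈ (B n).1 := by
        intro n
        induction n with
        | zero => exact hy
        | succ n ih =>
          by_contra h
          exact hne.2 n ⟨ih, h⟩
      obtain ⟨n, hn⟩ := hN.1.mem_iff.1 (isOpen_compl_singleton.mem_nhds (Ne.symm hne.1 : x ≠ y))
      exact hn.2 (hBs n (hall (n + 1))).2 rfl
    · rintro y (rfl | hy)
      · exact hx
      · obtain ⟨k, hk⟩ := mem_iUnion.1 hy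
        exact hBa (Nat.zero_le k) hk.1
  · intro M hM
    obtain ⟨n, hn⟩ := hN.1.mem_iff.1 hM
    refine ⟨n + 1, fun k hk => ?_⟩
    exact ((sdiff_subset.trans (hBa hk)).trans ((hBs n).trans inter_subset_right)).trans hn.2

/-- A countable crowded metric space carries a scheme of clopen sets `V s`, indexed by the finite
sequences, such that `V s` is the disjoint union of a point and the sets `V (k :: s)`, which
converge to that point. -/
theorem exists_clopen_scheme (T : Type*) [MetricSpace T] [Countable T] [Nonempty T]
    [∀ x : T, (𝓝[≠] x).NeBot] :
    ∃ (p : List ℕ → T) (V : List ℕ → Set T), Function.Bijective p ∧ (∀ s, IsClopen (V s)) ∧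
      (∀ s t, p t ∈ V s ↔ s <:+ t) ∧ ∀ s, ∀ N ∈ 𝓝 (p s), ∃ K, ∀ k ≥ K, V (k :: s) ⊆ N := by
  obtain ⟨e, he⟩ := exists_injective_nat T
  -- Always splitting at the point of least index ensures that every point is eventually used.
  have hmin : ∀ V : {V : Set T // IsClopen V ∧ V.Nonempty}, ∃ x ∈ V.1, ∀ y ∈ V.1, e x ≤ e y := by
    rintro ⟨V, -, hne⟩
    obtain ⟨x, hx, h⟩ := (measure e).wf.has_min V hne
    exact ⟨x, hx, fun y hy => not_lt.1 (h y hy)⟩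
  choose c hcV hcmin using hmin
  choose P hP1 hP2 hP3 hP4 hP5 hP6 using fun V : {V : Set T // IsClopen V ∧ V.Nonempty} =>
    exists_clopen_partition V.2.1 (hcV V)
  let W : List ℕ → {V : Set T // IsClopen V ∧ V.Nonempty} := fun s =>
    List.rec ⟨univ, isClopen_univ, univ_nonempty⟩ (fun k _ V => ⟨P V k, hP1 V k, hP2 V k⟩) s
  let p : List ℕ → T := fun s => c (W s)
  have hsub : ∀ k s, (W (k :: s)).1 ⊆ (W s).1 := by
    intro k s
    conv_rhs => rw [hP4 (W s)]
    exact (subset_iUnion (P (W s)) k).trans (subset_insert _ _)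
  have hpW : ∀ s, p s ∈ (W s).1 := fun s => hcV (W s)
  have hsplit : ∀ s, ∀ q ∈ (W s).1, q = p s ∨ ∃ k, q ∈ (W (k :: s)).1 := by
    intro s q hq
    rw [hP4 (W s)] at hq
    exact hq.imp id mem_iUnion.1
  have hpn : ∀ k s, p s ∉ (W (k :: s)).1 := fun k s => hP5 (W s) k
  have hlen : ∀ s, s.length ≤ e (p s) := by
    intro s
    induction s with
    | nil => exact Nat.zero_le _
    | cons k s ih =>
      have h1 : e (p s) ≤ e (p (k :: s)) := hcmin (W s) _ (hsub k s (hpW (k :: s)))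
      have h2 : e (p s) ≠ e (p (k :: s)) := fun h => hpn k s (he h ▸ hpW (k :: s))
      rw [List.length_cons]
      omega
  have hmono : ∀ r s : List ℕ, (W (r ++ s)).1 ⊆ (W s).1 := by
    intro r s
    induction r with
    | nil => exact Subset.rfl
    | cons i r ih => exact (hsub _ _).trans ih
  have hsuf : ∀ s t, p t ∈ (W s).1 ↔ s <:+ t := by
    intro s t
    constructor
    · intro h
      induction s with
      | nil => exact List.nil_suffix
      | cons k s ih =>
        obtain ⟨r, rfl⟩ := ih (hsub k s h)
        -- Sequences are stored in reverse, so the last entry of `r` is the first step below `s`.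
        rcases r.eq_nil_or_concat' with rfl | ⟨r', j, rfl⟩
        · exact (hpn k s h).elim
        · have hj : p (r' ++ j :: s) ∈ (W (j :: s)).1 := hmono r' (j :: s) (hpW _)
          simp only [List.append_assoc, List.singleton_append] at h ⊢
          by_cases hjk : j = k
          · exact ⟨r', by rw [hjk]⟩
          · exact (disjoint_left.1 (hP3 (W s) hjk) hj h).elim
    · rintro ⟨r, rfl⟩
      exact hmono r s (hpW _)
  refine ⟨p, fun s => (W s).1, ⟨?_, ?_⟩, fun s => (W s).2.1, hsuf, fun s N hN =>
    hP6 (W s) N hN⟩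
  · intro s t hst
    have h1 : s <:+ t := (hsuf s t).1 (hst ▸ hpW s)
    have h2 : t <:+ s := (hsuf t s).1 (hst ▸ hpW t)
    exact h1.eq_of_length (le_antisymm h1.length_le h2.length_le)
  · intro q
    by_contra hq
    have hex : ∀ n, ∃ s : List ℕ, s.length = n ∧ q ∈ (W s).1 := by
      intro n
      induction n with
      | zero => exact ⟨[], rfl, mem_univ q⟩
      | succ n ih =>
        obtain ⟨s, hs, hqs⟩ := ih
        rcases hsplit s q hqs with h | ⟨k, hk⟩
        · exact (hq ⟨s, h.symm⟩).elim
        · exact ⟨k :: s, by simp [hs], hk⟩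
    obtain ⟨s, hs, hqs⟩ := hex (e q + 1)
    have h1 := hlen s
    have h2 : e (p s) ≤ e q := hcmin (W s) q hqs
    omega

/-- Removing finitely many child sets from `V s` leaves a neighbourhood of `p s`, and the remaining
children go to sets already close to `p' s`. -/
theorem continuous_of_clopen_schemes {T T' : Type*} [TopologicalSpace T] [TopologicalSpace T']
    {p : List ℕ → T} {V : List ℕ → Set T} {p' : List ℕ → T'} {V' : List ℕ → Set T'}
    (hp : Function.Surjective p) (hV : ∀ s, IsClopen (V s))
    (hpV : ∀ s t, p t ∈ V s ↔ s <:+ t) (hpV' : ∀ s t, p' t ∈ V' s ↔ s <:+ t)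
    (hN : ∀ s, ∀ N ∈ 𝓝 (p' s), ∃ K, ∀ k ≥ K, V' (k :: s) ⊆ N) {g : T → T'}
    (hg : ∀ s, g (p s) = p' s) : Continuous g := by
  refine continuous_iff_continuousAt.2 fun x => ?_
  obtain ⟨s, rfl⟩ := hp x
  intro N hNs
  rw [hg] at hNs
  obtain ⟨K, hK⟩ := hN s N hNs
  have hO : IsOpen (V s ∩ ⋂ k ∈ Finset.range K, (V (k :: s))ᶜ) :=
    (hV s).isOpen.inter (isOpen_biInter_finset fun k _ => (hV _).isClosed.isOpen_compl)
  refine Filter.mem_map.2 (Filter.mem_of_superset (hO.mem_nhds ⟨(hpV s s).2 List.suffix_rfl, ?_⟩) ?_)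
  · refine mem_iInter₂.2 fun k _ h => ?_
    have := ((hpV _ _).1 h).length_le
    simp at this
  · rintro q ⟨hq, hq'⟩
    obtain ⟨t, rfl⟩ := hp q
    rw [mem_preimage, hg]
    obtain ⟨r, rfl⟩ := (hpV s t).1 hq
    rcases r.eq_nil_or_concat' with rfl | ⟨r', j, rfl⟩
    · exact mem_of_mem_nhds hNs
    · have hj : j :: s <:+ r' ++ [j] ++ s := ⟨r', by simp⟩
      have hjK : K ≤ j := by
        by_contra hlt
        exact mem_iInter₂.1 hq' j (Finset.mem_range.2 (not_le.1 hlt)) ((hpV _ _).2 hj)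
      exact hK j hjK ((hpV' _ _).2 hj)

/-- Two countable nonempty metric spaces without isolated points are homeomorphic. -/
theorem nonempty_homeomorph_of_countable_of_crowded (T T' : Type*) [MetricSpace T] [Countable T]
    [Nonempty T] [∀ x : T, (𝓝[≠] x).NeBot] [MetricSpace T'] [Countable T'] [Nonempty T']
    [∀ x : T', (𝓝[≠] x).NeBot] : Nonempty (T ≃ₜ T') := by
  obtain ⟨p, V, hp, hV, hpV, hN⟩ := exists_clopen_scheme T
  obtain ⟨p', V', hp', hV', hpV', hN'⟩ := exists_clopen_scheme T'
  let a := Equiv.ofBijective p hp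
  let b := Equiv.ofBijective p' hp'
  refine ⟨⟨a.symm.trans b, ?_, ?_⟩⟩
  · refine continuous_of_clopen_schemes hp.2 hV hpV hpV' hN' fun s => ?_
    exact congrArg b (a.symm_apply_apply s)
  · refine continuous_of_clopen_schemes hp'.2 hV' hpV' hpV hN fun s => ?_
    exact congrArg a (b.symm_apply_apply s)

/-- Sierpiński's characterization of the space of rational numbers. -/
theorem nonempty_homeomorph_rat (T : Type*) [TopologicalSpace T] [T3Space T]
    [FirstCountableTopology T] [Countable T] [Nonempty T] (h : ∀ x : T, (𝓝[≠] x).NeBot) :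
    Nonempty (T ≃ₜ ℚ) := by
  let := TopologicalSpace.metrizableSpaceMetric T
  exact nonempty_homeomorph_of_countable_of_crowded T ℚ

end CountableCrowded

/-! ### Recursive choice of a sequence. -/

section Recursion

/-- Construction of a sequence, one term at a time, from the list of all the previous terms. -/
theorem exists_seq_forall_of_extend {α : Type*} (P : ℕ → (ℕ → α) → Prop)
    (hloc : ∀ n h h', (∀ i ≤ n, h i = h' i) → P n h → P n h') (h0 : ∃ h, P 0 h)
    (hs : ∀ n h, P n h → ∃ a, P (n + 1) (Function.update h (n + 1) a)) : ∃ h, ∀ n, P n h := by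
  obtain ⟨h₀, h0⟩ := h0
  have : Nonempty α := ⟨h₀ 0⟩
  choose! a ha using hs
  let H : ℕ → ℕ → α := fun n => Nat.rec h₀ (fun n h => Function.update h (n + 1) (a n h)) n
  have hP : ∀ n, P n (H n) := by
    intro n
    induction n with
    | zero => exact h0
    | succ n ih => exact ha n _ ih
  have hdiag : ∀ i k, H (i + k) i = H i i := by
    intro i k
    induction k with
    | zero => rfl
    | succ k ih =>
      rw [← ih]
      exact Function.update_of_ne (by lia : i ≠ i + k + 1) _ _
  refine ⟨fun i => H i i, fun n => hloc n _ _ (fun i hi => ?_) (hP n)⟩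
  obtain ⟨k, rfl⟩ := Nat.exists_eq_add_of_le hi
  exact hdiag i k

end Recursion

/-! ### Construction of the tree of points. -/

section Scheme

variable {X : Type u} {Y : Type v}

/-- A point of `X` with a neighbourhood, a neighbourhood of its image and a finite sequence. -/
structure SchemeNode (X : Type u) (Y : Type v) where
  pt : X
  nhd : Set X
  im : Set Y
  seq : List ℕ

variable [TopologicalSpace X]

/-- The conditions on the node `m + 1`, which is a child of the node `(Nat.unpair m).1`. -/
structure IsSchemeStep (G : X → ℕ → Set X) (C : Set Y → ℕ → Set X) (h : ℕ → SchemeNode X Y)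
    (m : ℕ) : Prop where
  seq_eq : ∃ k, (h (m + 1)).seq = k :: (h m.unpair.1).seq
  subset_base : (h (m + 1)).nhd ⊆ G (h m.unpair.1).pt m
  subset : ∀ j ≤ m, (h m.unpair.1).pt ∈ (h j).nhd → (h (m + 1)).nhd ⊆ (h j).nhd
  disjoint : ∀ j ≤ m, (h m.unpair.1).pt ∉ (h j).nhd → Disjoint (h (m + 1)).nhd (h j).nhd
  notMem : ∀ j ≤ m, (h j).pt ∉ closure (h (m + 1)).nhd
  avoid : ∀ j ≤ m, ∀ l ≤ m, Disjoint (closure (h (m + 1)).nhd) (C (h j).im l)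

variable {G : X → ℕ → Set X} {C : Set Y → ℕ → Set X}

theorem IsSchemeStep.congr {h h' : ℕ → SchemeNode X Y} {m : ℕ} (g : IsSchemeStep G C h m)
    (hh : ∀ i ≤ m + 1, h i = h' i) : IsSchemeStep G C h' m := by
  have h1 := hh (m + 1) le_rfl
  have h2 := hh m.unpair.1 ((Nat.unpair_left_le m).trans m.le_succ)
  have h3 : ∀ i ≤ m, h i = h' i := fun i hi => hh i (hi.trans m.le_succ)
  constructor
  · rw [← h1, ← h2]; exact g.seq_eq
  · rw [← h1, ← h2]; exact g.subset_base
  · intro j hj; rw [← h1, ← h2, ← h3 j hj]; exact g.subset j hj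
  · intro j hj; rw [← h1, ← h2, ← h3 j hj]; exact g.disjoint j hj
  · intro j hj; rw [← h1, ← h3 j hj]; exact g.notMem j hj
  · intro j hj; rw [← h1, ← h3 j hj]; exact g.avoid j hj

variable [TopologicalSpace Y]

/-- The conditions on the nodes `0, …, n`. -/
structure IsSchemeUpTo (f : X → Y) (E : List ℕ → Set X) (G : X → ℕ → Set X)
    (C : Set Y → ℕ → Set X) (n : ℕ) (h : ℕ → SchemeNode X Y) : Prop where
  root_seq : (h 0).seq = []
  root_nhd : (h 0).nhd = univ
  isOpen_nhd : ∀ i ≤ n, IsOpen (h i).nhd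
  pt_mem : ∀ i ≤ n, (h i).pt ∈ (h i).nhd
  isOpen_im : ∀ i ≤ n, IsOpen (h i).im
  map_mem : ∀ i ≤ n, f (h i).pt ∈ (h i).im
  irr : ∀ i ≤ n,
    IsIrreducibleAt f (E (h i).seq) (⋃ j ∈ Finset.range (n + 1), closure (h j).im) (h i).pt
  sep : ∀ i ≤ n, ∀ j ≤ n, (h i).pt ∈ (h j).nhd ∨ (h i).pt ∉ closure (h j).nhd
  disj : ∀ i ≤ n, ∀ j < i, Disjoint (h i).im (h j).im
  step : ∀ m < n, IsSchemeStep G C h m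

variable {f : X → Y} {E : List ℕ → Set X}

theorem IsSchemeUpTo.congr {h h' : ℕ → SchemeNode X Y} {n : ℕ} (g : IsSchemeUpTo f E G C n h)
    (hh : ∀ i ≤ n, h i = h' i) : IsSchemeUpTo f E G C n h' := by
  have hU : (⋃ j ∈ Finset.range (n + 1), closure (h' j).im) =
      ⋃ j ∈ Finset.range (n + 1), closure (h j).im :=
    iUnion₂_congr fun j hj => by rw [hh j (Finset.mem_range_succ_iff.1 hj)]
  constructor
  · rw [← hh 0 n.zero_le]; exact g.root_seq
  · rw [← hh 0 n.zero_le]; exact g.root_nhd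
  · intro i hi; rw [← hh i hi]; exact g.isOpen_nhd i hi
  · intro i hi; rw [← hh i hi]; exact g.pt_mem i hi
  · intro i hi; rw [← hh i hi]; exact g.isOpen_im i hi
  · intro i hi; rw [← hh i hi]; exact g.map_mem i hi
  · intro i hi; rw [hU, ← hh i hi]; exact g.irr i hi
  · intro i hi j hj; rw [← hh i hi, ← hh j hj]; exact g.sep i hi j hj
  · intro i hi j hj; rw [← hh i hi, ← hh j (hj.le.trans hi)]; exact g.disj i hi j hj
  · exact fun m hm => (g.step m hm).congr fun i hi => hh i (hi.trans hm)

theorem exists_isSchemeUpTo_zero [RegularSpace Y] (hX : IsPerfectlyParacompact X)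
    (hf : IsSigmaTwoMeasurable f) (hE : E [] = univ) (hnpc : ¬ IsPiecewiseContinuous f) :
    ∃ h, IsSchemeUpTo f E G C 0 h := by
  obtain ⟨x, -, U, hU, hxU, -, hirr⟩ := exists_isIrreducibleAt_union_closure hX hf
    (E := E []) isOpen_univ (isClosed_empty (X := Y)) (fun h => hnpc
      (isPiecewiseContinuous_of_isPiecewiseSmall_univ (h.mono (by simp [hE]))))
  refine ⟨fun _ => ⟨x, univ, U, []⟩, rfl, rfl, fun _ _ => isOpen_univ, fun _ _ => mem_univ _,
    fun _ _ => hU, fun _ _ => hxU, fun _ _ => ?_, fun _ _ _ _ => Or.inl (mem_univ _), ?_, ?_⟩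
  · simpa using hirr
  · intro i hi j hj
    omega
  · intro m hm
    omega

/-- The parent is irreducible, so near it there is a new irreducible point whose value avoids all
old images. A small enough neighbourhood of that point then meets the remaining conditions. -/
theorem IsSchemeUpTo.exists_extend [RegularSpace Y] [T3Space X] (hX : IsPerfectlyParacompact X)
    (hf : IsSigmaTwoMeasurable f) (hE : ∀ σ, E σ ⊆ ⋃ k, E (k :: σ))
    (hG : ∀ x n, IsOpen (G x n)) (hxG : ∀ x n, x ∈ G x n)
    (hC : ∀ U, IsOpen U → ∀ l, IsClosed (C U l)) (hCU : ∀ U, IsOpen U → ∀ l, C U l ⊆ f ⁻¹' U)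
    {n : ℕ} {h : ℕ → SchemeNode X Y} (g : IsSchemeUpTo f E G C n h) :
    ∃ a, IsSchemeUpTo f E G C (n + 1) (Function.update h (n + 1) a) := by
  classical
  set s := n.unpair.1
  have hs : s ≤ n := Nat.unpair_left_le n
  set A : Set Y := ⋃ j ∈ Finset.range (n + 1), closure (h j).im
  have hA : IsClosed A := isClosed_biUnion_finset fun j _ => isClosed_closure
  have himA : ∀ j ≤ n, closure (h j).im ⊆ A := fun j hj =>
    subset_biUnion_of_mem (u := fun j => closure (h j).im) (Finset.mem_range_succ_iff.2 hj)
  -- By `sep` the parent is never on the boundary of an old neighbourhood, so staying on its side is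
  -- an open condition.
  let S : ℕ → Set X := fun j =>
    if (h s).pt ∈ (h j).nhd then (h j).nhd else (closure (h j).nhd)ᶜ
  have hSo : ∀ j ≤ n, IsOpen (S j) := by
    intro j hj
    by_cases hsj : (h s).pt ∈ (h j).nhd
    · simpa only [S, if_pos hsj] using g.isOpen_nhd j hj
    · simpa only [S, if_neg hsj] using isClosed_closure.isOpen_compl
  have hsS : ∀ j ≤ n, (h s).pt ∈ S j := by
    intro j hj
    by_cases hsj : (h s).pt ∈ (h j).nhd
    · simpa only [S, if_pos hsj] using hsj
    · rw [show S j = _ from if_neg hsj]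
      exact (g.sep s hs j hj).resolve_left hsj
  set W : Set X := G (h s).pt n ∩ ⋂ j ∈ Finset.range (n + 1), S j
  have hW : IsOpen W := (hG _ _).inter (isOpen_biInter_finset fun j hj =>
    hSo j (Finset.mem_range_succ_iff.1 hj))
  have hsW : (h s).pt ∈ W := ⟨hxG _ _, mem_iInter₂.2 fun j hj =>
    hsS j (Finset.mem_range_succ_iff.1 hj)⟩
  have hWS : ∀ j ≤ n, W ⊆ S j := fun j hj x hx =>
    mem_iInter₂.1 hx.2 j (Finset.mem_range_succ_iff.2 hj)
  -- Countably many small sets have a small union, so some one-step extension of the sequence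
  -- carries a non-small part.
  obtain ⟨k, hk⟩ : ∃ k, ¬ IsPiecewiseSmall f (W ∩ (E (k :: (h s).seq) ∩ f ⁻¹' Aᶜ)) := by
    by_contra! hall
    refine g.irr s hs W hW hsW ((IsPiecewiseSmall.iUnion hall).mono ?_)
    rintro x ⟨hxW, hxE, hxA⟩
    obtain ⟨k, hk⟩ := mem_iUnion.1 (hE _ hxE)
    exact mem_iUnion.2 ⟨k, hxW, hk, hxA⟩
  obtain ⟨x, hxW, U, hU, hxU, hUA, hirr, hirrs⟩ :=
    exists_isIrreducibleAt_union_closure_of_finite hX hf hW (Finset.range (n + 1))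
      (fun i => E (h i).seq) (fun i => (h i).pt) hA
      (fun i hi => g.irr i (Finset.mem_range_succ_iff.1 hi)) hk
  have hUim : ∀ j ≤ n, Disjoint U (h j).im := fun j hj =>
    hUA.mono subset_closure (subset_closure.trans (himA j hj))
  set O : Set X := W ∩ ⋂ j ∈ Finset.range (n + 1),
    ({(h j).pt}ᶜ ∩ ⋂ l ∈ Finset.range (n + 1), (C (h j).im l)ᶜ)
  have hO : IsOpen O := hW.inter <| isOpen_biInter_finset fun j hj =>
    isOpen_compl_singleton.inter <| isOpen_biInter_finset fun l _ =>
      (hC _ (g.isOpen_im j (Finset.mem_range_succ_iff.1 hj)) l).isOpen_compl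
  have hxO : x ∈ O := by
    refine ⟨hxW, mem_iInter₂.2 fun j hj => ?_⟩
    have hj := Finset.mem_range_succ_iff.1 hj
    refine ⟨?_, mem_iInter₂.2 fun l _ hl => ?_⟩
    · rintro rfl
      exact disjoint_left.1 (hUim j hj) hxU (g.map_mem j hj)
    · exact disjoint_left.1 (hUim j hj) hxU (hCU _ (g.isOpen_im j hj) l hl)
  obtain ⟨V, hV, hxV, hVO⟩ := exists_isOpen_closure_disjoint hO.isClosed_compl
    (y := x) (fun hx => hx hxO)
  rw [disjoint_compl_right_iff_subset] at hVO
  have hVO' := subset_closure.trans hVO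
  have hOj : ∀ j ≤ n, O ⊆ {(h j).pt}ᶜ ∩ ⋂ l ∈ Finset.range (n + 1), (C (h j).im l)ᶜ :=
    fun j hj y hy => mem_iInter₂.1 hy.2 j (Finset.mem_range_succ_iff.2 hj)
  refine ⟨⟨x, V, U, k :: (h s).seq⟩, ?_⟩
  set h' := Function.update h (n + 1) ⟨x, V, U, k :: (h s).seq⟩
  have hnew : h' (n + 1) = ⟨x, V, U, k :: (h s).seq⟩ := Function.update_self _ _ _
  have hold : ∀ i ≤ n, h' i = h i := fun i hi => Function.update_of_ne (by omega) _ _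
  have g' := g.congr fun i hi => (hold i hi).symm
  have hA' : (⋃ j ∈ Finset.range (n + 1 + 1), closure (h' j).im) = A ∪ closure U := by
    rw [Finset.range_add_one, Finset.set_biUnion_insert, hnew, union_comm]
    congr 1
    exact iUnion₂_congr fun j hj => by rw [hold j (Finset.mem_range_succ_iff.1 hj)]
  have hcases : ∀ i ≤ n + 1, i ≤ n ∨ i = n + 1 := fun i hi => by omega
  refine ⟨g'.root_seq, g'.root_nhd, ?_, ?_, ?_, ?_, ?_, ?_, ?_, ?_⟩
  · intro i hi
    rcases hcases i hi with hi | rfl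
    · exact g'.isOpen_nhd i hi
    · rwa [hnew]
  · intro i hi
    rcases hcases i hi with hi | rfl
    · exact g'.pt_mem i hi
    · rwa [hnew]
  · intro i hi
    rcases hcases i hi with hi | rfl
    · exact g'.isOpen_im i hi
    · rwa [hnew]
  · intro i hi
    rcases hcases i hi with hi | rfl
    · exact g'.map_mem i hi
    · rwa [hnew]
  · intro i hi
    rw [hA']
    rcases hcases i hi with hi | rfl
    · rw [hold i hi]
      exact hirrs i (Finset.mem_range_succ_iff.2 hi)
    · rwa [hnew]
  · intro i hi j hj
    rcases hcases j hj with hj | rfl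
    · rcases hcases i hi with hi | rfl
      · exact g'.sep i hi j hj
      · rw [hnew, hold j hj]
        have := hWS j hj hxW
        by_cases hsj : (h s).pt ∈ (h j).nhd
        · rw [show S j = _ from if_pos hsj] at this
          exact Or.inl this
        · rw [show S j = _ from if_neg hsj] at this
          exact Or.inr this
    · rw [hnew]
      rcases hcases i hi with hi | rfl
      · rw [hold i hi]
        exact Or.inr fun hc => (hOj i hi (hVO hc)).1 rfl
      · rw [hnew]
        exact Or.inl hxV
  · intro i hi j hj
    rcases hcases i hi with hi | rfl
    · exact g'.disj i hi j hj
    · rw [hnew, hold j (by omega)]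
      exact hUim j (by omega)
  · intro m hm
    rcases Nat.lt_succ_iff_lt_or_eq.1 hm with hm | rfl
    · exact g'.step m hm
    refine ⟨⟨k, ?_⟩, ?_, ?_, ?_, ?_, ?_⟩
    · rw [hnew, hold _ hs]
    · rw [hnew, hold _ hs]
      exact fun y hy => (hVO' hy).1.1
    · intro j hj
      rw [hnew, hold _ hs, hold j hj]
      intro hsj y hy
      have := hWS j hj (hVO' hy).1
      rwa [show S j = _ from if_pos hsj] at this
    · intro j hj
      rw [hnew, hold _ hs, hold j hj]
      intro hsj
      refine disjoint_left.2 fun y hy hyj => ?_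
      have := hWS j hj (hVO' hy).1
      rw [show S j = _ from if_neg hsj] at this
      exact this (subset_closure hyj)
    · intro j hj
      rw [hnew, hold j hj]
      exact fun hc => (hOj j hj (hVO hc)).1 rfl
    · intro j hj l hl
      rw [hnew, hold j hj]
      exact disjoint_left.2 fun y hy => mem_iInter₂.1 (hOj j hj (hVO hy)).2 l
        (Finset.mem_range_succ_iff.2 hl)

end Scheme

/-! ### Tree structure and crowdedness of the points. -/

section SchemeStructure

variable {X : Type u} {Y : Type v} [TopologicalSpace X] {E : List ℕ → Set X} {G : X → ℕ → Set X} {C : Set Y → ℕ → Set X}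
  {h : ℕ → SchemeNode X Y}

theorem IsSchemeStep.notMem_nhd (hst : ∀ m, IsSchemeStep G C h m) {i j : ℕ} (hij : i < j) :
    (h i).pt ∉ (h j).nhd := by
  obtain ⟨m, rfl⟩ := Nat.exists_eq_succ_of_ne_zero (Nat.ne_zero_of_lt hij)
  exact fun hi => (hst m).notMem i (Nat.lt_succ_iff.1 hij) (subset_closure hi)

theorem IsSchemeStep.parent_mem (hst : ∀ m, IsSchemeStep G C h m)
    (hpt : ∀ i, (h i).pt ∈ (h i).nhd) {m j : ℕ} (hj : j ≤ m) (hm : (h (m + 1)).pt ∈ (h j).nhd) :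
    (h m.unpair.1).pt ∈ (h j).nhd := by
  by_contra hne
  exact disjoint_left.1 ((hst m).disjoint j hj hne) (hpt _) hm

/-- Climb from `i` through its ancestors, which stay in the neighbourhood of `j` until `j` is
reached; the last node before `j` is the child wanted. -/
theorem IsSchemeStep.eq_or_exists_child (hst : ∀ m, IsSchemeStep G C h m)
    (hpt : ∀ i, (h i).pt ∈ (h i).nhd) {i j : ℕ} (hij : (h i).pt ∈ (h j).nhd) :
    i = j ∨ ∃ m, m.unpair.1 = j ∧ (h i).pt ∈ (h (m + 1)).nhd := by
  induction i using Nat.strong_induction_on with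
  | _ i ih =>
    have hji : j ≤ i := not_lt.1 fun hlt => notMem_nhd hst hlt hij
    rcases hji.eq_or_lt with rfl | hlt
    · exact Or.inl rfl
    obtain ⟨m, rfl⟩ := Nat.exists_eq_succ_of_ne_zero (Nat.ne_zero_of_lt hlt)
    have hs := Nat.unpair_left_le m
    have hp := parent_mem hst hpt (Nat.lt_succ_iff.1 hlt) hij
    rcases ih _ (Nat.lt_succ_iff.2 hs) hp with h1 | ⟨k, hk, hpk⟩
    · exact Or.inr ⟨m, h1, hpt _⟩
    · refine Or.inr ⟨k, hk, (hst m).subset (k + 1) ?_ hpk (hpt _)⟩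
      by_contra hlt'
      exact notMem_nhd hst (by omega) hpk

theorem IsSchemeStep.subset_of_mem (hst : ∀ m, IsSchemeStep G C h m)
    (hpt : ∀ i, (h i).pt ∈ (h i).nhd) (hE : ∀ k σ, E (k :: σ) ⊆ E σ) {i j : ℕ}
    (hij : (h i).pt ∈ (h j).nhd) : E (h i).seq ⊆ E (h j).seq := by
  induction i using Nat.strong_induction_on with
  | _ i ih =>
    have hji : j ≤ i := not_lt.1 fun hlt => notMem_nhd hst hlt hij
    rcases hji.eq_or_lt with rfl | hlt
    · exact Subset.rfl
    obtain ⟨m, rfl⟩ := Nat.exists_eq_succ_of_ne_zero (Nat.ne_zero_of_lt hlt)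
    obtain ⟨k, hk⟩ := (hst m).seq_eq
    rw [hk]
    exact (hE _ _).trans (ih _ (Nat.lt_succ_iff.2 (Nat.unpair_left_le m))
      (parent_mem hst hpt (Nat.lt_succ_iff.1 hlt) hij))

theorem IsSchemeStep.exists_child_ne (hst : ∀ m, IsSchemeStep G C h m)
    (hpt : ∀ i, (h i).pt ∈ (h i).nhd) {i : ℕ}
    (hGN : ∀ N ∈ 𝓝 (h i).pt, ∃ M, ∀ m ≥ M, G (h i).pt m ⊆ N) {N : Set X}
    (hN : N ∈ 𝓝 (h i).pt) : ∃ j, (h j).pt ∈ N ∧ (h j).pt ≠ (h i).pt := by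
  obtain ⟨M, hM⟩ := hGN N hN
  -- Node `Nat.pair i M + 1` is a child of `i`, and its base index `Nat.pair i M` is at least `M`.
  have hst' := hst (Nat.pair i M)
  have hsub := hst'.subset_base
  rw [Nat.unpair_pair] at hsub
  refine ⟨Nat.pair i M + 1, hM _ (Nat.right_le_pair i M) (hsub (hpt _)), fun heq => ?_⟩
  exact hst'.notMem i (Nat.left_le_pair i M) (heq ▸ subset_closure (hpt _))

end SchemeStructure

/-! ### Limits of the tree in the ambient space. -/

section SubspaceScheme

variable {Z : Type u} {Y : Type v} [TopologicalSpace Z] {X : Set Z}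
  {G : X → ℕ → Set X} {C : Set Y → ℕ → Set X} {h : ℕ → SchemeNode X Y}

/-- The points of the scheme that lie in the neighbourhood of the node `j`. -/
def schemeCone (h : ℕ → SchemeNode X Y) (j : ℕ) : Set Z :=
  (↑) '' {x : X | x ∈ (h j).nhd ∧ ∃ i, x = (h i).pt}

/-- All but finitely many child cones lie in a neighbourhood of the node's point whose closure
misses `z`, and closure commutes with the finite union of the others. -/
theorem exists_child_mem_closure_schemeCone [T3Space Z] (hst : ∀ m, IsSchemeStep G C h m)
    (hpt : ∀ i, (h i).pt ∈ (h i).nhd)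
    (hGN : ∀ x, ∀ N ∈ 𝓝 x, ∃ M, ∀ m ≥ M, G x m ⊆ N) {z : Z} {j : ℕ}
    (hz : z ∈ closure (schemeCone h j)) (hzj : z ≠ (h j).pt) :
    ∃ m, m.unpair.1 = j ∧ z ∈ closure (schemeCone h (m + 1)) := by
  obtain ⟨N, hN, hjN, hzN⟩ := exists_isOpen_closure_disjoint (isClosed_singleton (x := z))
    (y := ((h j).pt : Z)) (fun hh => hzj (mem_singleton_iff.1 hh).symm)
  obtain ⟨M, hM⟩ := hGN (h j).pt _
    ((hN.preimage continuous_subtype_val).mem_nhds (x := (h j).pt) hjN)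
  have hfin : {m | m < M ∧ m.unpair.1 = j}.Finite := (finite_lt_nat M).subset fun m hm => hm.1
  have hsub : schemeCone h j ⊆
      N ∪ ⋃ m ∈ {m | m < M ∧ m.unpair.1 = j}, schemeCone h (m + 1) := by
    rintro _ ⟨_, ⟨hij, i, rfl⟩, rfl⟩
    rcases IsSchemeStep.eq_or_exists_child hst hpt hij with rfl | ⟨m, hm, him⟩
    · exact Or.inl hjN
    · by_cases hmM : m < M
      · exact Or.inr (mem_biUnion (show m ∈ {m | m < M ∧ m.unpair.1 = j} from ⟨hmM, hm⟩)
          ⟨_, ⟨him, i, rfl⟩, rfl⟩)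
      · have := (hst m).subset_base him
        rw [hm] at this
        exact Or.inl (hM m (not_lt.1 hmM) this)
  have hz' := closure_mono hsub hz
  rw [closure_union, hfin.closure_biUnion] at hz'
  rcases hz' with hz' | hz'
  · exact (disjoint_left.1 hzN hz' rfl).elim
  · obtain ⟨m, hm, hzm⟩ := mem_iUnion₂.1 hz'
    exact ⟨m, hm.2, hzm⟩

/-- A limit of the points of the scheme which is not one of them lies on an infinite branch. -/
theorem exists_branch [T3Space Z] (hst : ∀ m, IsSchemeStep G C h m)
    (hpt : ∀ i, (h i).pt ∈ (h i).nhd) (hroot : (h 0).nhd = univ)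
    (hseq : (h 0).seq = [])
    (hGN : ∀ x, ∀ N ∈ 𝓝 x, ∃ M, ∀ m ≥ M, G x m ⊆ N) {z : Z}
    (hz : z ∈ closure ((↑) '' range fun i => (h i).pt : Set Z)) (hzD : ∀ i, z ≠ (h i).pt) :
    ∃ (J : ℕ → ℕ) (β : ℕ → ℕ), (∀ n, (J n) < J (n + 1)) ∧
      (∀ n, z ∈ closure (schemeCone h (J n))) ∧ ∀ n, (h (J n)).seq = PiNat.res β n := by
  have h0 : z ∈ closure (schemeCone h 0) := by
    refine closure_mono (image_mono ?_) hz
    rintro _ ⟨i, rfl⟩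
    exact ⟨by simp [hroot], i, rfl⟩
  have hnext : ∀ j : {j // z ∈ closure (schemeCone h j)},
      ∃ j' : {j // z ∈ closure (schemeCone h j)}, j.1 < j'.1 ∧
        ∃ k, (h j').seq = k :: (h j).seq := by
    rintro ⟨j, hj⟩
    obtain ⟨m, rfl, hzm⟩ := exists_child_mem_closure_schemeCone hst hpt hGN hj (hzD j)
    exact ⟨⟨m + 1, hzm⟩, Nat.lt_succ_iff.2 (Nat.unpair_left_le m), (hst m).seq_eq⟩
  choose g hg1 β hg2 using hnext
  let J : ℕ → {j // z ∈ closure (schemeCone h j)} := fun n => Nat.rec ⟨0, h0⟩ (fun _ => g) n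
  refine ⟨fun n => (J n).1, fun n => β (J n), fun n => hg1 (J n), fun n => (J n).2, fun n => ?_⟩
  induction n with
  | zero => exact hseq
  | succ n ih =>
    rw [PiNat.res_succ, ← ih]
    exact hg2 (J n)

end SubspaceScheme

/-! ### Souslin parts and the final assembly. -/

section Souslin

variable {Z : Type u}

/-- The part of the result of the Souslin operation on `F` that comes from the branches with the
initial segment `σ`. -/
def souslinPart (X : Set Z) (F : List ℕ → Set Z) (σ : List ℕ) : Set X :=
  {x | ∃ β : ℕ → ℕ, PiNat.res β σ.length = σ ∧ ∀ n, (x : Z) ∈ F (PiNat.res β n)}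

variable {X : Set Z} {F : List ℕ → Set Z}

theorem souslinPart_nil (hX : X = ⋃ β : ℕ → ℕ, ⋂ n, F (PiNat.res β n)) :
    souslinPart X F [] = univ := by
  refine eq_univ_of_forall fun x => ?_
  have hx : (x : Z) ∈ ⋃ β : ℕ → ℕ, ⋂ n, F (PiNat.res β n) := hX ▸ x.2
  obtain ⟨β, hβ⟩ := mem_iUnion.1 hx
  exact ⟨β, rfl, mem_iInter.1 hβ⟩

theorem souslinPart_subset_iUnion (σ : List ℕ) :
    souslinPart X F σ ⊆ ⋃ k, souslinPart X F (k :: σ) := by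
  rintro x ⟨β, hβ, hx⟩
  exact mem_iUnion.2 ⟨β σ.length, β, by rw [List.length_cons, PiNat.res_succ, hβ], hx⟩

theorem souslinPart_cons_subset (k : ℕ) (σ : List ℕ) :
    souslinPart X F (k :: σ) ⊆ souslinPart X F σ := by
  rintro x ⟨β, hβ, hx⟩
  rw [List.length_cons, PiNat.res_succ] at hβ
  exact ⟨β, (List.cons.inj hβ).2, hx⟩

theorem souslinPart_subset (σ : List ℕ) : souslinPart X F σ ⊆ (↑) ⁻¹' F σ := by
  rintro x ⟨β, hβ, hx⟩
  rw [mem_preimage, ← hβ]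
  exact hx _

end Souslin

theorem exists_nhds_open_sequence (X : Type u) [TopologicalSpace X] [FirstCountableTopology X] :
    ∃ G : X → ℕ → Set X, (∀ x n, IsOpen (G x n)) ∧ (∀ x n, x ∈ G x n) ∧
      ∀ x, ∀ N ∈ 𝓝 x, ∃ M, ∀ m ≥ M, G x m ⊆ N := by
  choose B hB using fun x : X => (𝓝 x).exists_antitone_basis
  refine ⟨fun x n => interior (B x n), fun x n => isOpen_interior,
    fun x n => mem_interior_iff_mem_nhds.2 ((hB x).1.mem_of_mem trivial), fun x N hN => ?_⟩
  obtain ⟨M, -, hM⟩ := (hB x).1.mem_iff.1 hN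
  exact ⟨M, fun m hm => interior_subset.trans (((hB x).2 hm).trans hM)⟩

theorem lemma6 {Z : Type u} {Y : Type v} [TopologicalSpace Z] [TopologicalSpace Y]
    [T3Space Z] [T3Space Y] (X : Set Z) (hX : IsSouslinF X)
    (hpp : IsPerfectlyParacompact X) (hfc : FirstCountableTopology X)
    (f : X → Y) (hf : IsSigmaTwoMeasurable f) (hnpc : ¬ IsPiecewiseContinuous f) :
    ∃ (D : Set X) (d : ℕ → X) (U : ℕ → Set Y),
      D.Countable ∧ D = Set.range d ∧
      (∀ n, IsOpen (U n)) ∧ (∀ m n, m ≠ n → Disjoint (U m) (U n)) ∧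
      (∀ n, f (d n) ∈ U n) ∧
      Nonempty (D ≃ₜ ℚ) ∧
      closure ((↑) '' D : Set Z) ⊆ X ∧
      (∀ x : X, (x : Z) ∈ closure ((↑) '' D : Set Z) → x ∉ D → f x ∉ ⋃ n, U n) := by
  obtain ⟨F, hF, hXF⟩ := hX
  obtain ⟨G, hG, hxG, hGN⟩ := exists_nhds_open_sequence X
  have hf' := hf
  choose! C hC hCU using hf'
  obtain ⟨h, hh⟩ := exists_seq_forall_of_extend
    (fun n h => IsSchemeUpTo f (souslinPart X F) G C n h) (fun n h h' hh g => g.congr hh)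
    (exists_isSchemeUpTo_zero hpp hf (souslinPart_nil hXF) hnpc)
    (fun n h g => g.exists_extend hpp hf souslinPart_subset_iUnion hG hxG hC
      (fun U hU l => (hCU U hU).symm ▸ subset_iUnion (C U) l))
  have hst : ∀ m, IsSchemeStep G C h m := fun m => (hh (m + 1)).step m m.lt_succ_self
  have hpt : ∀ i, (h i).pt ∈ (h i).nhd := fun i => (hh i).pt_mem i le_rfl
  have him : ∀ i, IsOpen (h i).im := fun i => (hh i).isOpen_im i le_rfl
  have hconeF : ∀ j, closure (schemeCone h j) ⊆ F (h j).seq := by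
    refine fun j => closure_minimal ?_ (hF _)
    rintro _ ⟨_, ⟨hij, i, rfl⟩, rfl⟩
    -- Irreducibility only puts a point in the closure of its Souslin part, which suffices because
    -- `F` is closed.
    refine closure_minimal (souslinPart_subset (h j).seq)
      ((hF _).preimage continuous_subtype_val) ?_
    exact closure_mono (IsSchemeStep.subset_of_mem hst hpt souslinPart_cons_subset hij)
      ((hh i).irr i le_rfl).mem_closure
  have hbranch := fun z => exists_branch (z := z) hst hpt (hh 0).root_nhd (hh 0).root_seq hGN
  refine ⟨range fun i => (h i).pt, fun i => (h i).pt, fun i => (h i).im, countable_range _, rfl,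
    him, ?_, fun i => (hh i).map_mem i le_rfl, ?_, ?_, ?_⟩
  · intro m n hmn
    rcases hmn.lt_or_gt with hlt | hlt
    · exact ((hh n).disj n le_rfl m hlt).symm
    · exact (hh m).disj m le_rfl n hlt
  · have : Countable (range fun i => (h i).pt) := (countable_range _).to_subtype
    have : Nonempty (range fun i => (h i).pt) := (range_nonempty _).to_subtype
    refine nonempty_homeomorph_rat _ ?_
    rintro ⟨_, i, rfl⟩
    rw [← mem_closure_iff_nhdsWithin_neBot, mem_closure_iff_nhds]
    intro N hN
    obtain ⟨N', hN', hsub⟩ := mem_nhds_subtype _ _ _ |>.1 hN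
    obtain ⟨j, hj, hne⟩ := IsSchemeStep.exists_child_ne hst hpt (hGN _) hN'
    exact ⟨⟨_, j, rfl⟩, hsub hj, fun heq => hne (congrArg Subtype.val heq)⟩
  · intro z hz
    by_cases hzD : ∃ i, z = (h i).pt
    · obtain ⟨i, rfl⟩ := hzD
      exact (h i).pt.2
    · push Not at hzD
      obtain ⟨J, β, -, hJz, hJβ⟩ := hbranch z hz hzD
      rw [hXF]
      exact mem_iUnion.2 ⟨β, mem_iInter.2 fun n => hJβ n ▸ hconeF _ (hJz n)⟩
  · intro x hx hxD hxU
    obtain ⟨j, hj⟩ := mem_iUnion.1 hxU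
    obtain ⟨l, hl⟩ := mem_iUnion.1 ((hCU _ (him j)).subset hj)
    obtain ⟨J, β, hJ, hJz, -⟩ := hbranch x hx fun i hi => hxD ⟨i, (Subtype.ext hi).symm⟩
    -- This branch node has the form `m + 1` with `j, l ≤ m`, so `avoid` applies to `C (h j).im l`.
    have hJn : j + l + 1 ≤ J (j + l + 1) := (strictMono_nat_of_lt_succ hJ).le_apply
    obtain ⟨m, hm⟩ := Nat.exists_eq_succ_of_ne_zero (Nat.ne_zero_of_lt hJn)
    have hxm : x ∈ closure (h (m + 1)).nhd := by
      rw [closure_subtype]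
      have := hJz (j + l + 1)
      rw [hm] at this
      exact closure_mono (image_mono fun y hy => hy.1) this
    exact disjoint_left.1 ((hst m).avoid j (by omega) l (by omega)) hxm hl
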